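/- Fix $\alpha<1$ and a smooth cut-off $a:\mathbb R\to\mathbb R$ supported in $[-2,2]$ with $a=1$ on $[-1,1]$. There are constants $c,C>0$, depending only on $\alpha$ and $a$, such that the following holds for every $\lambda\ge 1$ and every $\gamma>0$ for which $N=\gamma\lambda$ is a positive integer (in particular uniformly as $\gamma\to\infty$), and every $p\in[0,1]$. Let $\xi_1,\dots,\xi_N$ be $N$ equi-spaced directions on the unit circle in $\mathbb R^2$ (consecutive angles differ by $2\pi/(\gamma\lambda)$), let $C_1,\dots,C_N$ be independent random variables, each equal to $+1$ with probability $p$ and to $-1$ with probability $1-p$, and let $$u(x)=\sum_{j=1}^N C_j e^{i\lambda x\cdot\xi_j},\qquad \|a_\lambda u\|_{L^2}^2=\int_{\mathbb R^2}a^2(\lambda^\alpha|x|)\,|u(x)|^2\,dx .$$ Then $$c\left(\gamma\lambda^{1-2\alpha}+(2p-1)^2\gamma^2\lambda^{1-\alpha}\right)\le \mathbb E\left[\|a_\lambda u\|_{L^2}^2\right]\le C\left(\gamma\lambda^{1-2\alpha}+(2p-1)^2\gamma^2\lambda^{1-\alpha}\right).$$ -/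

import Mathlib

open MeasureTheory ProbabilityTheory

/-- A smooth cut-off profile: supported on `[-2, 2]` and equal to one on `[-1, 1]`. -/
structure IsCutoff (a : ℝ → ℝ) : Prop where
  smooth : ContDiff ℝ (⊤ : ℕ∞) a
  support_subset : Function.support a ⊆ Set.Icc (-2) 2
  eq_one : ∀ r ∈ Set.Icc (-1 : ℝ) 1, a r = 1

/-- The `N` equi-spaced directions on the unit circle: `ξ_j` has angle `φ + 2πj/N`. -/
noncomputable def direction (N : ℕ) (φ : ℝ) (j : Fin N) : EuclideanSpace ℝ (Fin 2) :=
  !₂[Real.cos (φ + 2 * Real.pi * (j : ℕ) / N), Real.sin (φ + 2 * Real.pi * (j : ℕ) / N)]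

/-- The wave `u(x) = ∑_j C_j e^{i lam x·ξ_j}` with coefficients `C` and directions `ξ`. -/
noncomputable def wave {N : ℕ} (lam : ℝ) (ξ : Fin N → EuclideanSpace ℝ (Fin 2))
    (C : Fin N → ℝ) (x : EuclideanSpace ℝ (Fin 2)) : ℂ :=
  ∑ j, (C j : ℂ) * Complex.exp (Complex.I * ((lam * inner ℝ x (ξ j) : ℝ) : ℂ))

/-- The function `a_lam u`, that is `x ↦ a(lam^α |x|) u(x)`. -/
noncomputable def localize (a : ℝ → ℝ) (lam α : ℝ) (u : EuclideanSpace ℝ (Fin 2) → ℂ)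
    (x : EuclideanSpace ℝ (Fin 2)) : ℂ :=
  (a (lam ^ α * ‖x‖) : ℂ) * u x

/-- The squared `L²(ℝ²)` norm (with respect to Lebesgue measure). -/
noncomputable def l2NormSq (f : EuclideanSpace ℝ (Fin 2) → ℂ) : ℝ :=
  ∫ x, ‖f x‖ ^ 2

/-- The `C_j` are independent random variables, each equal to `+1` with probability `p`
and to `-1` with probability `1 - p`. -/
structure IsUnfairCoins {Ω : Type*} [MeasurableSpace Ω] (μ : Measure Ω) (p : ℝ) {N : ℕ}
    (C : Fin N → Ω → ℝ) : Prop where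
  measurable : ∀ j, Measurable (C j)
  indep : iIndepFun C μ
  prob_one : ∀ j, μ {ω | C j ω = 1} = ENNReal.ofReal p
  prob_neg_one : ∀ j, μ {ω | C j ω = -1} = ENNReal.ofReal (1 - p)

/-! Independence gives `E[C_j C_k] = 1` for `j = k` and `q = (2p-1)²` otherwise, so the expectation
is `∫ a² V` with `V = (1-q)N + q|∑ e^{iλx·ξ_j}|² ≥ 0` (`secondMoment`). Since `V` is nonnegative,
`a²` may be replaced by Gaussians: a multiple of `e^{-r²}` from above, `e^{-2r²} - e^{-1}e^{-r²}`
from below.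

Gaussian integrals of `V` are explicit (`integral_gaussian_mul_secondMoment`): with `s = λ^α` and `M
= λ^{1-α}`, each pair of directions contributes a Gaussian in `M|ξ_j - ξ_k|`. A row of this sum is
comparable to `1 + N/M`, since about `N/M` directions lie within `1/M` of a given one
(`chordGaussianSum_le`, `le_chordGaussianSum`). The total is of order `s⁻²(N + qN²/M)`, which is the
claim once `N = γλ`. -/

/-! ### Gaussian sums over the regular polygon -/

/-- The normalized row sum `∑_d exp(-t |ξ_0 - ξ_d|²)` of a Gaussian over the `N`-gon. -/
noncomputable def chordGaussianSum (N : ℕ) (t : ℝ) : ℝ :=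
  ∑ d ∈ Finset.range N, Real.exp (-t * (2 - 2 * Real.cos (2 * Real.pi * d / N)))

/-- The terms are dominated by a telescoping difference; the subtracted tail is what makes the
induction close. -/
lemma sum_range_inv_one_add_mul_sq_le {ε : ℝ} (hε : 0 < ε) (n : ℕ) :
    ∑ d ∈ Finset.range (n + 1), 1 / (1 + ε * d) ^ 2 ≤ 1 + 1 / ε - 1 / (ε * (1 + ε * n)) := by
  induction n with
  | zero => simp
  | succ n ih =>
    rw [Finset.sum_range_succ]
    have h1 : 0 < 1 + ε * n := by positivity
    have h2 : 0 < 1 + ε * (n + 1) := by positivity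
    have key : 1 / (1 + ε * ((n : ℝ) + 1)) ^ 2
        ≤ 1 / (ε * (1 + ε * n)) - 1 / (ε * (1 + ε * (n + 1))) := by
      have : 1 / (ε * (1 + ε * n)) - 1 / (ε * (1 + ε * ((n : ℝ) + 1)))
          = 1 / ((1 + ε * n) * (1 + ε * (n + 1))) := by
        field_simp
        ring
      rw [this, pow_two]
      apply one_div_le_one_div_of_le (by positivity)
      apply mul_le_mul_of_nonneg_right _ h2.le
      nlinarith
    push_cast
    linarith

lemma exp_neg_four_mul_sq_le {x : ℝ} (hx : 0 ≤ x) :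
    Real.exp (-(4 * x ^ 2)) ≤ 2 * (1 / (1 + x) ^ 2) := by
  rw [Real.exp_neg, mul_one_div, ← one_div, div_le_div_iff₀ (Real.exp_pos _) (by positivity)]
  have := Real.add_one_le_exp (4 * x ^ 2)
  nlinarith [sq_nonneg (1 - x)]

/-- The chord satisfies `2 - 2cos 2θ = 4sin²θ`, and Jordan's inequality gives `sin θ ≥ 2θ/π` for `θ
= πd/N ≤ π/2`. -/
lemma four_mul_sq_div_le_two_sub_two_mul_cos {N d : ℕ} (hN : 0 < N) (hd : 2 * d ≤ N) :
    16 * ((d : ℝ) / N) ^ 2 ≤ 2 - 2 * Real.cos (2 * Real.pi * d / N) := by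
  have hN' : (0 : ℝ) < N := by exact_mod_cast hN
  have hd' : 2 * (d : ℝ) ≤ N := by exact_mod_cast hd
  have h0 : 0 ≤ Real.pi * d / N := by positivity
  have h1 : Real.pi * d / N ≤ Real.pi / 2 := by
    rw [div_le_div_iff₀ hN' two_pos]
    nlinarith [Real.pi_pos]
  have h2 := Real.mul_le_sin h0 h1
  have h3 : 2 / Real.pi * (Real.pi * d / N) = 2 * (d / N) := by
    field_simp
  rw [h3] at h2
  have h4 : 2 * Real.pi * d / N = 2 * (Real.pi * d / N) := by ring
  rw [h4, Real.cos_two_mul, Real.cos_sq']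
  have : 0 ≤ (d : ℝ) / N := by positivity
  nlinarith

lemma exp_chord_le {N d : ℕ} (hN : 0 < N) (hd : 2 * d ≤ N) {M : ℝ} (hM : 0 < M) :
    Real.exp (-(M ^ 2 / 4) * (2 - 2 * Real.cos (2 * Real.pi * d / N)))
      ≤ 2 * (1 / (1 + M / N * d) ^ 2) := by
  refine le_trans ?_ (exp_neg_four_mul_sq_le (x := M / N * d) (by positivity))
  apply Real.exp_le_exp.mpr
  have := mul_le_mul_of_nonneg_left (four_mul_sq_div_le_two_sub_two_mul_cos hN hd)
    (show 0 ≤ M ^ 2 / 4 by positivity)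
  have h : 4 * (M / N * d) ^ 2 = M ^ 2 / 4 * (16 * ((d : ℝ) / N) ^ 2) := by ring
  rw [h]
  linarith

lemma chordGaussianSum_le {N : ℕ} (hN : 0 < N) {M : ℝ} (hM : 0 < M) :
    chordGaussianSum N (M ^ 2 / 4) ≤ 4 * (1 + N / M) := by
  have hN' : (0 : ℝ) < N := by exact_mod_cast hN
  set f : ℕ → ℝ := fun d => 2 * (1 / (1 + M / N * d) ^ 2) with hf
  have hf0 : ∀ d, 0 ≤ f d := fun d => by positivity
  have hS : ∑ d ∈ Finset.range (N + 1), f d ≤ 2 * (1 + N / M) := by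
    rw [hf, ← Finset.mul_sum]
    have h := sum_range_inv_one_add_mul_sq_le (ε := M / N) (by positivity) N
    have h' : 0 ≤ 1 / (M / N * (1 + M / N * N)) := by positivity
    rw [one_div_div] at h
    linarith
  -- The chord is symmetric under `d ↦ N - d`; adding both majorants avoids splitting the sum at
  -- `N/2`.
  have hterm : ∀ d ∈ Finset.range N,
      Real.exp (-(M ^ 2 / 4) * (2 - 2 * Real.cos (2 * Real.pi * d / N))) ≤ f d + f (N - d) := by
    intro d hd
    rw [Finset.mem_range] at hd
    rcases le_or_gt (2 * d) N with h | h
    · exact (exp_chord_le hN h hM).trans (le_add_of_nonneg_right (hf0 _))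
    · refine le_trans (le_of_eq ?_)
        ((exp_chord_le hN (d := N - d) (by omega) hM).trans (le_add_of_nonneg_left (hf0 _)))
      have : 2 * Real.pi * ((N - d : ℕ) : ℝ) / N = 2 * Real.pi - 2 * Real.pi * d / N := by
        rw [Nat.cast_sub hd.le]
        field_simp
      rw [this, Real.cos_two_pi_sub]
  -- The value `d = 0` reflects to `N`, hence the range `N + 1`.
  have hrefl : ∑ d ∈ Finset.range N, f (N - d) ≤ ∑ d ∈ Finset.range (N + 1), f d := by
    rw [← Finset.sum_range_reflect f (N + 1)]
    simp only [Nat.add_sub_cancel]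
    rw [Finset.sum_range_succ]
    exact le_add_of_nonneg_right (hf0 _)
  have hmono : ∑ d ∈ Finset.range N, f d ≤ ∑ d ∈ Finset.range (N + 1), f d := by
    rw [Finset.sum_range_succ]
    exact le_add_of_nonneg_right (hf0 _)
  have := Finset.sum_le_sum hterm
  rw [Finset.sum_add_distrib] at this
  unfold chordGaussianSum
  linarith

/-- Only the `⌈N/M⌉` indices `d < N/M` are kept. There `1 - cos x ≤ x²/2` bounds the exponent by
`π²/2 ≤ 5`. The assumption `M ≥ 1` keeps these indices below `N`. -/
lemma le_chordGaussianSum {N : ℕ} (hN : 0 < N) {M : ℝ} (hM : 1 ≤ M) :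
    Real.exp (-5) / 2 * (1 + N / M) ≤ chordGaussianSum N (M ^ 2 / 8) := by
  have hN' : (0 : ℝ) < N := by exact_mod_cast hN
  have hM0 : 0 < M := by linarith
  set n := ⌈(N : ℝ) / M⌉₊ with hn
  have hnN : n ≤ N := Nat.ceil_le.mpr (div_le_self hN'.le hM)
  have hn1 : (1 : ℝ) ≤ n := by
    exact_mod_cast Nat.one_le_iff_ne_zero.mpr (Nat.ceil_pos.mpr (by positivity)).ne'
  have hn2 : (N : ℝ) / M ≤ n := Nat.le_ceil _
  have hterm : ∀ d ∈ Finset.range n, Real.exp (-5) ≤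
      Real.exp (-(M ^ 2 / 8) * (2 - 2 * Real.cos (2 * Real.pi * d / N))) := by
    intro d hd
    have hd' : (d : ℝ) < N / M := Nat.lt_ceil.mp (Finset.mem_range.mp hd)
    apply Real.exp_le_exp.mpr
    have hcos := Real.one_sub_sq_div_two_le_cos (x := 2 * Real.pi * d / N)
    have hMd : M * (d / N) ≤ 1 := by
      rw [lt_div_iff₀ hM0] at hd'
      rw [← mul_div_assoc, div_le_one hN']
      linarith
    have hMd0 : 0 ≤ M * (d / N) := by positivity
    have hsq : (M * (d / N)) ^ 2 ≤ 1 := by nlinarith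
    have hpi : Real.pi ^ 2 ≤ 10 := by nlinarith [Real.pi_lt_d2, Real.pi_pos]
    have h1 : M ^ 2 / 8 * (2 * Real.pi * d / N) ^ 2 = Real.pi ^ 2 / 2 * (M * (d / N)) ^ 2 := by
      ring
    have h2 : M ^ 2 / 8 * (2 - 2 * Real.cos (2 * Real.pi * d / N))
        ≤ M ^ 2 / 8 * (2 * Real.pi * d / N) ^ 2 :=
      mul_le_mul_of_nonneg_left (by linarith) (by positivity)
    nlinarith [sq_nonneg Real.pi]
  have h3 : (n : ℝ) * Real.exp (-5) ≤ chordGaussianSum N (M ^ 2 / 8) := by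
    calc (n : ℝ) * Real.exp (-5) = ∑ _d ∈ Finset.range n, Real.exp (-5) := by simp
      _ ≤ _ := Finset.sum_le_sum hterm
      _ ≤ chordGaussianSum N (M ^ 2 / 8) :=
        Finset.sum_le_sum_of_subset_of_nonneg (Finset.range_subset_range.mpr hnN)
          fun _ _ _ => (Real.exp_pos _).le
  have := Real.exp_pos (-5)
  nlinarith

lemma chordGaussianSum_antitone (N : ℕ) : Antitone (chordGaussianSum N) := by
  intro s t hst
  refine Finset.sum_le_sum fun d _ => Real.exp_le_exp.mpr ?_
  have := Real.cos_le_one (2 * Real.pi * d / N)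
  nlinarith

/-! ### Distances between directions -/

lemma norm_direction_sub_sq {N : ℕ} (φ : ℝ) (j k : Fin N) :
    ‖direction N φ j - direction N φ k‖ ^ 2 =
      2 - 2 * Real.cos (2 * Real.pi * (k : ℕ) / N - 2 * Real.pi * (j : ℕ) / N) := by
  rw [EuclideanSpace.norm_sq_eq]
  have h : 2 * Real.pi * (k : ℕ) / N - 2 * Real.pi * (j : ℕ) / N
    = (φ + 2 * Real.pi * (k : ℕ) / N) - (φ + 2 * Real.pi * (j : ℕ) / N) := by ring
  rw [h, Real.cos_sub]
  simp only [direction, Fin.sum_univ_two, PiLp.sub_apply, Real.norm_eq_abs, sq_abs,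
    Matrix.cons_val_zero, Matrix.cons_val_one]
  nlinarith [Real.sin_sq_add_cos_sq (φ + 2 * Real.pi * (k : ℕ) / N),
    Real.sin_sq_add_cos_sq (φ + 2 * Real.pi * (j : ℕ) / N)]

lemma norm_direction_sub_add_sq {N : ℕ} [NeZero N] (φ : ℝ) (j d : Fin N) :
    ‖direction N φ j - direction N φ (j + d)‖ ^ 2 =
      2 - 2 * Real.cos (2 * Real.pi * (d : ℕ) / N) := by
  have hN : (N : ℝ) ≠ 0 := Nat.cast_ne_zero.mpr (NeZero.ne N)
  rw [norm_direction_sub_sq, Fin.val_add_eq_ite]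
  congr 2
  split_ifs with h
  · have : 2 * Real.pi * ((j + d - N : ℕ) : ℝ) / N - 2 * Real.pi * (j : ℕ) / N
        = 2 * Real.pi * (d : ℕ) / N - 2 * Real.pi := by
      rw [Nat.cast_sub h]
      push_cast
      field_simp
      ring
    rw [this, Real.cos_sub_two_pi]
  · congr 1
    push_cast
    ring

lemma sum_sum_exp_neg_norm_direction_sub_sq {N : ℕ} (hN : 0 < N) (φ t : ℝ) :
    ∑ j, ∑ k, Real.exp (-t * ‖direction N φ j - direction N φ k‖ ^ 2)
      = N * chordGaussianSum N t := by
  have : NeZero N := ⟨hN.ne'⟩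
  have h : ∀ j : Fin N, ∑ k, Real.exp (-t * ‖direction N φ j - direction N φ k‖ ^ 2)
      = chordGaussianSum N t := by
    intro j
    -- Cyclic shift `k = j + d` in `Fin N`: all rows have the same sum.
    rw [← Equiv.sum_comp (Equiv.addLeft j)]
    simp only [Equiv.coe_addLeft, norm_direction_sub_add_sq]
    exact Fin.sum_univ_eq_sum_range
      (fun d => Real.exp (-t * (2 - 2 * Real.cos (2 * Real.pi * d / N)))) N
  rw [Finset.sum_congr rfl fun j _ => h j]
  simp

-- Plane waves against Gaussians

local notation "E2" => EuclideanSpace ℝ (Fin 2)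

lemma norm_wave_sq {N : ℕ} (lam : ℝ) (ξ : Fin N → E2) (C : Fin N → ℝ) (x : E2) :
    ‖wave lam ξ C x‖ ^ 2 =
      ∑ j, ∑ k, C j * C k * Real.cos (lam * inner ℝ x (ξ j - ξ k)) := by
  have hw : wave lam ξ C x =
      ((∑ j, C j * Real.cos (lam * inner ℝ x (ξ j)) : ℝ) : ℂ) +
      ((∑ j, C j * Real.sin (lam * inner ℝ x (ξ j)) : ℝ) : ℂ) * Complex.I := by
    rw [wave, Complex.ofReal_sum, Complex.ofReal_sum, Finset.sum_mul, ← Finset.sum_add_distrib]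
    refine Finset.sum_congr rfl fun j _ => ?_
    rw [mul_comm Complex.I, Complex.exp_mul_I]
    push_cast
    ring
  rw [hw, ← Complex.normSq_eq_norm_sq, Complex.normSq_add_mul_I, pow_two, pow_two,
    Finset.sum_mul_sum, Finset.sum_mul_sum, ← Finset.sum_add_distrib]
  refine Finset.sum_congr rfl fun j _ => ?_
  rw [← Finset.sum_add_distrib]
  refine Finset.sum_congr rfl fun k _ => ?_
  rw [inner_sub_right, mul_sub, Real.cos_sub]
  ring

lemma cexp_neg_mul_norm_sq_add_re (β lam : ℝ) (w x : E2) :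
    (Complex.exp (-(β : ℂ) * (‖x‖ : ℂ) ^ 2 + (lam * Complex.I) * ((inner ℝ w x : ℝ) : ℂ))).re =
      Real.exp (-β * ‖x‖ ^ 2) * Real.cos (lam * inner ℝ x w) := by
  have h : -(β : ℂ) * (‖x‖ : ℂ) ^ 2 + (lam * Complex.I) * ((inner ℝ w x : ℝ) : ℂ)
      = ((-β * ‖x‖ ^ 2 : ℝ) : ℂ) + ((lam * inner ℝ x w : ℝ) : ℂ) * Complex.I := by
    rw [real_inner_comm]
    push_cast
    ring
  rw [h, Complex.exp_add, ← Complex.ofReal_exp, Complex.re_ofReal_mul, Complex.exp_ofReal_mul_I_re]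

lemma integrable_gaussian_mul_cos {β : ℝ} (hβ : 0 < β) (lam : ℝ) (w : E2) :
    Integrable fun x : E2 => Real.exp (-β * ‖x‖ ^ 2) * Real.cos (lam * inner ℝ x w) := by
  have h := (GaussianFourier.integrable_cexp_neg_mul_sq_norm_add (V := E2) (b := (β : ℂ))
    (by simpa using hβ) (lam * Complex.I) w).re
  refine h.congr (Filter.Eventually.of_forall fun x => ?_)
  exact cexp_neg_mul_norm_sq_add_re β lam w x

lemma integral_gaussian_mul_cos {β : ℝ} (hβ : 0 < β) (lam : ℝ) (w : E2) :
    ∫ x : E2, Real.exp (-β * ‖x‖ ^ 2) * Real.cos (lam * inner ℝ x w) =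
      Real.pi / β * Real.exp (-(lam ^ 2 / (4 * β)) * ‖w‖ ^ 2) := by
  have hb : 0 < (β : ℂ).re := by simpa using hβ
  have h := GaussianFourier.integral_cexp_neg_mul_sq_norm_add (V := E2) hb (lam * Complex.I) w
  have hr := integral_re (GaussianFourier.integrable_cexp_neg_mul_sq_norm_add (V := E2) hb
    (lam * Complex.I) w)
  have h2 : ((Module.finrank ℝ E2 : ℕ) / 2 : ℂ) = 1 := by
    simp
  rw [h, h2, Complex.cpow_one] at hr
  have h3 : (Real.pi / β : ℂ) * Complex.exp ((lam * Complex.I) ^ 2 * (‖w‖ : ℂ) ^ 2 / (4 * β)) =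
      ((Real.pi / β * Real.exp (-(lam ^ 2 / (4 * β)) * ‖w‖ ^ 2) : ℝ) : ℂ) := by
    push_cast
    rw [mul_pow, Complex.I_sq]
    congr 2
    ring
  rw [h3] at hr
  refine Eq.trans (integral_congr_ae (Filter.Eventually.of_forall fun x => ?_)) hr
  exact (cexp_neg_mul_norm_sq_add_re β lam w x).symm

/-! ### The second moment of the random wave -/

/-- The pointwise second moment `∑_{j,k} E[C_j C_k] cos(lam x·(ξ_j - ξ_k))` of a random wave whose
independent coefficients are signs with squared mean `q`. -/
noncomputable def secondMoment {N : ℕ} (lam : ℝ) (ξ : Fin N → E2) (q : ℝ) (x : E2) : ℝ :=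
  ∑ j, ∑ k, (if j = k then 1 else q) * Real.cos (lam * inner ℝ x (ξ j - ξ k))

lemma sum_sum_ite_eq_mul {N : ℕ} (q : ℝ) (F : Fin N → Fin N → ℝ) (hF : ∀ j, F j j = 1) :
    ∑ j, ∑ k, (if j = k then 1 else q) * F j k = (1 - q) * N + q * ∑ j, ∑ k, F j k := by
  have h : ∀ j k, (if j = k then 1 else q) * F j k =
      (if j = k then (1 - q) * F j k else 0) + q * F j k := by
    intro j k
    split_ifs <;> ring
  simp only [h, Finset.sum_add_distrib, Finset.sum_ite_eq, Finset.mem_univ, if_true, hF,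
    ← Finset.mul_sum]
  simp [mul_comm]

/-- The off-diagonal weight `q` splits off a multiple of the squared modulus of the wave with all
coefficients one. This positivity is what permits replacing the cut-off by Gaussians. -/
lemma secondMoment_nonneg {N : ℕ} (lam : ℝ) (ξ : Fin N → E2) {q : ℝ} (hq0 : 0 ≤ q) (hq1 : q ≤ 1)
    (x : E2) : 0 ≤ secondMoment lam ξ q x := by
  rw [secondMoment, sum_sum_ite_eq_mul q _ (by simp)]
  have h := norm_wave_sq lam ξ (fun _ => 1) x
  simp only [one_mul] at h
  rw [← h]
  have : 0 ≤ 1 - q := by linarith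
  positivity

lemma continuous_secondMoment {N : ℕ} (lam : ℝ) (ξ : Fin N → E2) (q : ℝ) :
    Continuous (secondMoment lam ξ q) := by
  unfold secondMoment
  fun_prop

lemma integrable_gaussian_mul_secondMoment {N : ℕ} {β : ℝ} (hβ : 0 < β) (lam : ℝ)
    (ξ : Fin N → E2) (q : ℝ) :
    Integrable fun x : E2 => Real.exp (-β * ‖x‖ ^ 2) * secondMoment lam ξ q x := by
  simp only [secondMoment, Finset.mul_sum, mul_left_comm (Real.exp _)]
  exact integrable_finsetSum _ fun j _ => integrable_finsetSum _ fun k _ =>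
    (integrable_gaussian_mul_cos hβ lam _).const_mul _

lemma integral_gaussian_mul_secondMoment {N : ℕ} (hN : 0 < N) {β : ℝ} (hβ : 0 < β)
    (lam φ q : ℝ) :
    ∫ x : E2, Real.exp (-β * ‖x‖ ^ 2) * secondMoment lam (direction N φ) q x =
      Real.pi / β * ((1 - q) * N + q * (N * chordGaussianSum N (lam ^ 2 / (4 * β)))) := by
  simp only [secondMoment, Finset.mul_sum, mul_left_comm (Real.exp _)]
  have hint := fun j k => (integrable_gaussian_mul_cos hβ lam
    (direction N φ j - direction N φ k)).const_mul (if j = k then 1 else q)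
  rw [integral_finsetSum _ fun j _ => integrable_finsetSum _ fun k _ => hint j k]
  simp only [integral_finsetSum _ fun k _ => hint _ k, integral_const_mul,
    integral_gaussian_mul_cos hβ, mul_left_comm _ (Real.pi / β)]
  simp only [← Finset.mul_sum]
  rw [sum_sum_ite_eq_mul q _ (by simp), sum_sum_exp_neg_norm_direction_sub_sq hN]

/-! ### Moments of the coins -/

lemma IsUnfairCoins.ae_eq {Ω : Type*} [MeasurableSpace Ω] {μ : Measure Ω} [IsProbabilityMeasure μ]
    {p : ℝ} (hp0 : 0 ≤ p) (hp1 : p ≤ 1) {N : ℕ} {C : Fin N → Ω → ℝ} (h : IsUnfairCoins μ p C)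
    (j : Fin N) : ∀ᵐ ω ∂μ, C j ω = 1 ∨ C j ω = -1 := by
  have hm : MeasurableSet {ω | C j ω = 1} := h.measurable j (measurableSet_singleton 1)
  have hm' : MeasurableSet {ω | C j ω = -1} := h.measurable j (measurableSet_singleton (-1))
  have hd : Disjoint {ω | C j ω = 1} {ω | C j ω = -1} := by
    rw [Set.disjoint_left]
    intro ω h1 h2
    have h1 : C j ω = 1 := h1
    have h2 : C j ω = -1 := h2
    linarith
  have hu : μ ({ω | C j ω = 1} ∪ {ω | C j ω = -1}) = 1 := by
    rw [measure_union hd hm', h.prob_one, h.prob_neg_one,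
      ← ENNReal.ofReal_add hp0 (by linarith)]
    simp
  exact (prob_compl_eq_zero_iff (hm.union hm')).mpr hu

lemma IsUnfairCoins.integral_eq {Ω : Type*} [MeasurableSpace Ω] {μ : Measure Ω}
    [IsProbabilityMeasure μ] {p : ℝ} (hp0 : 0 ≤ p) (hp1 : p ≤ 1) {N : ℕ} {C : Fin N → Ω → ℝ}
    (h : IsUnfairCoins μ p C) (j : Fin N) : ∫ ω, C j ω ∂μ = 2 * p - 1 := by
  have hm : MeasurableSet {ω | C j ω = 1} := h.measurable j (measurableSet_singleton 1)
  have he : C j =ᵐ[μ] fun ω => 2 * {ω | C j ω = 1}.indicator (fun _ => (1 : ℝ)) ω - 1 := by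
    filter_upwards [h.ae_eq hp0 hp1 j] with ω hω
    rcases hω with hω | hω
    · rw [Set.indicator_of_mem (show ω ∈ {ω | C j ω = 1} from hω), hω]
      norm_num
    · rw [Set.indicator_of_notMem (show ω ∉ {ω | C j ω = 1} from fun h1 => by
        have h1 : C j ω = 1 := h1
        linarith), hω]
      norm_num
  rw [integral_congr_ae he, integral_sub ((integrable_const _).indicator hm |>.const_mul 2)
    (integrable_const _), integral_const_mul, integral_indicator_const _ hm, measureReal_def,
    h.prob_one, ENNReal.toReal_ofReal hp0]
  simp

lemma IsUnfairCoins.integrable_mul {Ω : Type*} [MeasurableSpace Ω] {μ : Measure Ω}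
    [IsProbabilityMeasure μ] {p : ℝ} (hp0 : 0 ≤ p) (hp1 : p ≤ 1) {N : ℕ} {C : Fin N → Ω → ℝ}
    (h : IsUnfairCoins μ p C) (j k : Fin N) : Integrable (fun ω => C j ω * C k ω) μ := by
  refine Integrable.of_bound ((h.measurable j).mul (h.measurable k)).aestronglyMeasurable 1 ?_
  filter_upwards [h.ae_eq hp0 hp1 j, h.ae_eq hp0 hp1 k] with ω hj hk
  rcases hj with hj | hj <;> rcases hk with hk | hk <;> simp [hj, hk]

lemma IsUnfairCoins.integral_mul {Ω : Type*} [MeasurableSpace Ω] {μ : Measure Ω}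
    [IsProbabilityMeasure μ] {p : ℝ} (hp0 : 0 ≤ p) (hp1 : p ≤ 1) {N : ℕ} {C : Fin N → Ω → ℝ}
    (h : IsUnfairCoins μ p C) (j k : Fin N) :
    ∫ ω, C j ω * C k ω ∂μ = if j = k then 1 else (2 * p - 1) ^ 2 := by
  split_ifs with hjk
  · subst hjk
    have he : (fun ω => C j ω * C j ω) =ᵐ[μ] fun _ => 1 := by
      filter_upwards [h.ae_eq hp0 hp1 j] with ω hω
      rcases hω with hω | hω <;> simp [hω]
    simp [integral_congr_ae he]
  · have := (h.indep.indepFun hjk).integral_mul_eq_mul_integral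
      (h.measurable j).aestronglyMeasurable (h.measurable k).aestronglyMeasurable
    simp only [Pi.mul_apply] at this
    rw [this, h.integral_eq hp0 hp1, h.integral_eq hp0 hp1, pow_two]

/-! ### Expectation of the localized norm -/

lemma continuous_wave {N : ℕ} (lam : ℝ) (ξ : Fin N → E2) (C : Fin N → ℝ) :
    Continuous (wave lam ξ C) := by
  unfold wave
  fun_prop

lemma IsCutoff.continuous_comp {a : ℝ → ℝ} (ha : IsCutoff a) (s : ℝ) :
    Continuous fun x : E2 => a (s * ‖x‖) :=
  ha.smooth.continuous.comp (by fun_prop)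

lemma IsCutoff.hasCompactSupport_comp {a : ℝ → ℝ} (ha : IsCutoff a) {s : ℝ} (hs : 0 < s) :
    HasCompactSupport fun x : E2 => a (s * ‖x‖) := by
  refine HasCompactSupport.intro (isCompact_closedBall (0 : E2) (2 / s)) fun x hx => ?_
  by_contra h
  apply hx
  rw [mem_closedBall_zero_iff, le_div_iff₀ hs, mul_comm]
  exact (ha.support_subset h).2

lemma IsCutoff.memLp_localize {a : ℝ → ℝ} (ha : IsCutoff a) {lam : ℝ} (hlam : 0 < lam) (α : ℝ)
    {u : E2 → ℂ} (hu : Continuous u) : MemLp (localize a lam α u) 2 volume := by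
  have hs : 0 < lam ^ α := Real.rpow_pos_of_pos hlam α
  unfold localize
  apply Continuous.memLp_of_hasCompactSupport
  · exact (Complex.continuous_ofReal.comp (ha.continuous_comp _)).mul hu
  · exact ((ha.hasCompactSupport_comp hs).comp_left (g := Complex.ofReal) (by simp)).mul_right

lemma IsCutoff.integrable_sq_mul {a : ℝ → ℝ} (ha : IsCutoff a) {s : ℝ} (hs : 0 < s)
    {F : E2 → ℝ} (hF : Continuous F) : Integrable fun x : E2 => a (s * ‖x‖) ^ 2 * F x := by
  apply Continuous.integrable_of_hasCompactSupport
  · exact ((ha.continuous_comp s).pow 2).mul hF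
  · exact ((ha.hasCompactSupport_comp hs).comp_left (g := fun y => y ^ 2) (by simp)).mul_right

/-- The norm is a finite quadratic form in the coefficients with a deterministic kernel, so the
expectation only has to pass through finite sums. -/
lemma IsCutoff.l2NormSq_localize_wave {a : ℝ → ℝ} (ha : IsCutoff a) {lam : ℝ} (hlam : 0 < lam)
    (α : ℝ) {N : ℕ} (ξ : Fin N → E2) (C : Fin N → ℝ) :
    l2NormSq (localize a lam α (wave lam ξ C)) = ∑ j, ∑ k, C j * C k *
      ∫ x : E2, a (lam ^ α * ‖x‖) ^ 2 * Real.cos (lam * inner ℝ x (ξ j - ξ k)) := by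
  have hs : 0 < lam ^ α := Real.rpow_pos_of_pos hlam α
  have hint := fun j k => (ha.integrable_sq_mul hs
    (show Continuous fun x : E2 => Real.cos (lam * inner ℝ x (ξ j - ξ k)) by fun_prop)).const_mul
      (C j * C k)
  simp only [l2NormSq, localize, norm_mul, Complex.norm_real, Real.norm_eq_abs, mul_pow, sq_abs,
    norm_wave_sq, Finset.mul_sum, mul_left_comm (a _ ^ 2)]
  rw [integral_finsetSum _ fun j _ => integrable_finsetSum _ fun k _ => hint j k]
  simp only [integral_finsetSum _ fun k _ => hint _ k, integral_const_mul]

lemma IsCutoff.integral_l2NormSq {a : ℝ → ℝ} (ha : IsCutoff a) {lam : ℝ} (hlam : 0 < lam)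
    (α : ℝ) {N : ℕ} (ξ : Fin N → E2) {Ω : Type*} [MeasurableSpace Ω] {μ : Measure Ω}
    [IsProbabilityMeasure μ] {p : ℝ} (hp0 : 0 ≤ p) (hp1 : p ≤ 1) {C : Fin N → Ω → ℝ}
    (h : IsUnfairCoins μ p C) :
    Integrable (fun ω => l2NormSq (localize a lam α (wave lam ξ fun j => C j ω))) μ ∧
    ∫ ω, l2NormSq (localize a lam α (wave lam ξ fun j => C j ω)) ∂μ =
      ∫ x : E2, a (lam ^ α * ‖x‖) ^ 2 * secondMoment lam ξ ((2 * p - 1) ^ 2) x := by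
  have hs : 0 < lam ^ α := Real.rpow_pos_of_pos hlam α
  simp only [ha.l2NormSq_localize_wave hlam]
  have hint := fun j k => (h.integrable_mul hp0 hp1 j k).mul_const
    (∫ x : E2, a (lam ^ α * ‖x‖) ^ 2 * Real.cos (lam * inner ℝ x (ξ j - ξ k)))
  refine ⟨integrable_finsetSum _ fun j _ => integrable_finsetSum _ fun k _ => hint j k, ?_⟩
  rw [integral_finsetSum _ fun j _ => integrable_finsetSum _ fun k _ => hint j k]
  simp only [integral_finsetSum _ fun k _ => hint _ k, integral_mul_const,
    h.integral_mul hp0 hp1]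
  have hint' := fun j k => (ha.integrable_sq_mul hs
    (show Continuous fun x : E2 => Real.cos (lam * inner ℝ x (ξ j - ξ k)) by fun_prop)).const_mul
      (if j = k then 1 else (2 * p - 1) ^ 2)
  simp only [secondMoment, Finset.mul_sum, mul_left_comm (a _ ^ 2)]
  rw [integral_finsetSum _ fun j _ => integrable_finsetSum _ fun k _ => hint' j k]
  simp only [integral_finsetSum _ fun k _ => hint' _ k, integral_const_mul]

/-! ### Gaussian bounds for the cut-off -/

lemma IsCutoff.exists_sq_le_gaussian {a : ℝ → ℝ} (ha : IsCutoff a) :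
    ∃ B : ℝ, 0 < B ∧ ∀ r, a r ^ 2 ≤ B * Real.exp (-r ^ 2) := by
  obtain ⟨D, hD⟩ := isCompact_Icc.exists_bound_of_continuousOn (s := Set.Icc (-2 : ℝ) 2)
    (ha.smooth.continuous.continuousOn)
  have hD0 : 0 ≤ D := (norm_nonneg _).trans (hD 0 (by norm_num))
  -- The factor `e⁴` compensates `e^{-r²}` on `|r| ≤ 2`; the `+ 1` keeps the constant positive.
  refine ⟨(D ^ 2 + 1) * Real.exp 4, by positivity, fun r => ?_⟩
  by_cases hr : r ∈ Set.Icc (-2 : ℝ) 2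
  · have h1 : a r ^ 2 ≤ D ^ 2 := sq_le_sq' (by linarith [abs_le.mp (hD r hr)])
      (abs_le.mp (hD r hr)).2
    have h2 : 1 ≤ Real.exp 4 * Real.exp (-r ^ 2) := by
      rw [← Real.exp_add]
      apply Real.one_le_exp
      nlinarith [hr.1, hr.2]
    nlinarith [sq_nonneg D]
  · have : a r = 0 := by
      by_contra h
      exact hr (ha.support_subset h)
    rw [this, zero_pow two_ne_zero]
    positivity

/-- A difference of Gaussians lying below the indicator of the unit ball, with positive Fourier
transform in the plane. -/
lemma IsCutoff.gaussian_sub_le_sq {a : ℝ → ℝ} (ha : IsCutoff a) (r : ℝ) :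
    Real.exp (-2 * r ^ 2) - Real.exp (-1) * Real.exp (-r ^ 2) ≤ a r ^ 2 := by
  by_cases hr : r ∈ Set.Icc (-1 : ℝ) 1
  · rw [ha.eq_one r hr]
    have h1 : Real.exp (-2 * r ^ 2) ≤ 1 := Real.exp_le_one_iff.mpr (by nlinarith [sq_nonneg r])
    have h2 : 0 ≤ Real.exp (-1) * Real.exp (-r ^ 2) := by positivity
    linarith
  · have h1 : 1 ≤ r ^ 2 := by
      by_contra h
      exact hr (abs_le.mp ((sq_lt_one_iff_abs_lt_one r).mp (not_le.mp h)).le)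
    rw [← Real.exp_add]
    have : Real.exp (-2 * r ^ 2) ≤ Real.exp (-1 + -r ^ 2) := Real.exp_le_exp.mpr (by linarith)
    linarith [sq_nonneg (a r)]

/-! ### Two-sided bounds for the integrated second moment -/

section

variable {a : ℝ → ℝ} {lam s M φ q : ℝ} {N : ℕ}

/-- The wider Gaussian `e^{-r²}` has the narrower transform, so its polygon sum is no larger than
that of `e^{-2r²}`. The subtraction therefore leaves at least the fraction `1/2 - e^{-1} > 0`, where
`1/2` is the ratio of the prefactors `π/β`. -/
lemma IsCutoff.le_integral_secondMoment (ha : IsCutoff a) (hs : 0 < s) (hM : 1 ≤ M)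
    (hlam : lam = M * s) (hN : 0 < N) (hq0 : 0 ≤ q) (hq1 : q ≤ 1) :
    Real.pi * (1 / 2 - Real.exp (-1)) * (Real.exp (-5) / 2) *
        ((1 / s ^ 2) * (N + q * (N ^ 2 / M))) ≤
      ∫ x : E2, a (s * ‖x‖) ^ 2 * secondMoment lam (direction N φ) q x := by
  set V := secondMoment lam (direction N φ) q with hV
  have hV0 : ∀ x, 0 ≤ V x := secondMoment_nonneg lam _ hq0 hq1
  have hs2 : 0 < s ^ 2 := by positivity
  have hi1 := integrable_gaussian_mul_secondMoment hs2 lam (direction N φ) q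
  have hi2 := integrable_gaussian_mul_secondMoment (show 0 < 2 * s ^ 2 by positivity) lam
    (direction N φ) q
  have hle : ∫ x : E2, (Real.exp (-(2 * s ^ 2) * ‖x‖ ^ 2) * V x
      - Real.exp (-1) * (Real.exp (-s ^ 2 * ‖x‖ ^ 2) * V x)) ≤
      ∫ x : E2, a (s * ‖x‖) ^ 2 * V x := by
    refine integral_mono (hi2.sub (hi1.const_mul _))
      (ha.integrable_sq_mul hs (continuous_secondMoment _ _ _)) fun x => ?_
    have h := mul_le_mul_of_nonneg_right (ha.gaussian_sub_le_sq (s * ‖x‖)) (hV0 x)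
    have e1 : -2 * (s * ‖x‖) ^ 2 = -(2 * s ^ 2) * ‖x‖ ^ 2 := by ring
    have e2 : -(s * ‖x‖) ^ 2 = -s ^ 2 * ‖x‖ ^ 2 := by ring
    rw [e1, e2, sub_mul, mul_assoc] at h
    exact h
  refine le_trans ?_ hle
  rw [integral_sub hi2 (hi1.const_mul _), integral_const_mul,
    integral_gaussian_mul_secondMoment hN hs2,
    integral_gaussian_mul_secondMoment hN (by positivity)]
  have t1 : lam ^ 2 / (4 * s ^ 2) = M ^ 2 / 4 := by
    rw [hlam]
    field_simp
  have t2 : lam ^ 2 / (4 * (2 * s ^ 2)) = M ^ 2 / 8 := by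
    rw [hlam]
    field_simp
    norm_num
  rw [t1, t2]
  have hmono : chordGaussianSum N (M ^ 2 / 4) ≤ chordGaussianSum N (M ^ 2 / 8) :=
    chordGaussianSum_antitone N (by nlinarith)
  have hlow := le_chordGaussianSum hN hM
  set G := chordGaussianSum N (M ^ 2 / 8)
  set G' := chordGaussianSum N (M ^ 2 / 4)
  have hN0 : (0 : ℝ) < N := by exact_mod_cast hN
  have hM0 : 0 < M := by linarith
  have he : Real.exp (-1) < 1 / 2 := by
    rw [Real.exp_neg, one_div]
    exact inv_strictAnti₀ two_pos (by linarith [Real.exp_one_gt_d9])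
  have he5 : Real.exp (-5) / 2 ≤ 1 := by
    have : Real.exp (-5) ≤ 1 := Real.exp_le_one_iff.mpr (by norm_num)
    linarith
  have hA : (1 - q) * N + q * (N * G') ≤ (1 - q) * N + q * (N * G) := by gcongr
  have hB : Real.exp (-5) / 2 * (N + q * (N ^ 2 / M)) ≤ (1 - q) * N + q * (N * G) := by
    have h1 : Real.exp (-5) / 2 * ((1 - q) * N) ≤ 1 * ((1 - q) * N) :=
      mul_le_mul_of_nonneg_right he5 (mul_nonneg (by linarith) hN0.le)
    have h2 : q * (N * (Real.exp (-5) / 2 * (1 + N / M))) ≤ q * (N * G) := by gcongr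
    calc _ = Real.exp (-5) / 2 * ((1 - q) * N)
          + q * (N * (Real.exp (-5) / 2 * (1 + N / M))) := by ring
      _ ≤ _ := by linarith
  set T := (1 - q) * N + q * (N * G)
  set T' := (1 - q) * N + q * (N * G')
  calc _ = Real.pi / s ^ 2 * ((1 / 2 - Real.exp (-1)) *
        (Real.exp (-5) / 2 * (N + q * (N ^ 2 / M)))) := by ring
    _ ≤ Real.pi / s ^ 2 * ((1 / 2 - Real.exp (-1)) * T) := by
      have : 0 ≤ 1 / 2 - Real.exp (-1) := by linarith
      gcongr
    _ = Real.pi / (2 * s ^ 2) * T - Real.exp (-1) * (Real.pi / s ^ 2 * T) := by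
      field_simp
    _ ≤ _ := by gcongr

lemma integral_secondMoment_le (ha : IsCutoff a) {B : ℝ} (hB : 0 < B)
    (haB : ∀ r, a r ^ 2 ≤ B * Real.exp (-r ^ 2)) (hs : 0 < s) (hM : 0 < M)
    (hlam : lam = M * s) (hN : 0 < N) (hq0 : 0 ≤ q) (hq1 : q ≤ 1) :
    ∫ x : E2, a (s * ‖x‖) ^ 2 * secondMoment lam (direction N φ) q x ≤
      B * Real.pi * 4 * ((1 / s ^ 2) * (N + q * (N ^ 2 / M))) := by
  set V := secondMoment lam (direction N φ) q with hV
  have hV0 : ∀ x, 0 ≤ V x := secondMoment_nonneg lam _ hq0 hq1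
  have hs2 : 0 < s ^ 2 := by positivity
  have hi1 := integrable_gaussian_mul_secondMoment hs2 lam (direction N φ) q
  have hle : ∫ x : E2, a (s * ‖x‖) ^ 2 * V x ≤
      ∫ x : E2, B * (Real.exp (-s ^ 2 * ‖x‖ ^ 2) * V x) := by
    refine integral_mono (ha.integrable_sq_mul hs (continuous_secondMoment _ _ _))
      (hi1.const_mul _) fun x => ?_
    have h := mul_le_mul_of_nonneg_right (haB (s * ‖x‖)) (hV0 x)
    have e2 : -(s * ‖x‖) ^ 2 = -s ^ 2 * ‖x‖ ^ 2 := by ring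
    rw [e2, mul_assoc] at h
    exact h
  refine hle.trans ?_
  rw [integral_const_mul, integral_gaussian_mul_secondMoment hN hs2]
  have t1 : lam ^ 2 / (4 * s ^ 2) = M ^ 2 / 4 := by
    rw [hlam]
    field_simp
  rw [t1]
  have hup := chordGaussianSum_le hN hM
  set G' := chordGaussianSum N (M ^ 2 / 4)
  have hN0 : (0 : ℝ) < N := by exact_mod_cast hN
  have hT : (1 - q) * N + q * (N * G') ≤ 4 * (N + q * (N ^ 2 / M)) := by
    have h1 : (1 - q) * N ≤ 4 * ((1 - q) * N) := by
      have : 0 ≤ (1 - q) * N := mul_nonneg (by linarith) hN0.le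
      linarith
    have h2 : q * (N * G') ≤ q * (N * (4 * (1 + N / M))) := by gcongr
    calc _ ≤ 4 * ((1 - q) * N) + q * (N * (4 * (1 + N / M))) := by linarith
      _ = _ := by ring
  calc B * (Real.pi / s ^ 2 * ((1 - q) * N + q * (N * G')))
      ≤ B * (Real.pi / s ^ 2 * (4 * (N + q * (N ^ 2 / M)))) := by gcongr
    _ = _ := by ring

end

/-! ### Scaling and conclusion -/

lemma scaling_identity {α lam γ q N : ℝ} (hlam : 0 < lam) (hN : N = γ * lam) :
    1 / (lam ^ α) ^ 2 * (N + q * (N ^ 2 / lam ^ (1 - α))) =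
      γ * lam ^ (1 - 2 * α) + q * γ ^ 2 * lam ^ (1 - α) := by
  have hs : 0 < lam ^ α := Real.rpow_pos_of_pos hlam α
  have h1 : lam ^ (1 - α) = lam / lam ^ α := by rw [Real.rpow_sub hlam, Real.rpow_one]
  have h2 : lam ^ (1 - 2 * α) = lam / (lam ^ α) ^ 2 := by
    rw [Real.rpow_sub hlam, Real.rpow_one, mul_comm 2 α, Real.rpow_mul hlam.le]
    norm_num
  rw [h1, h2, hN]
  field_simp

theorem theorem2 (α : ℝ) (hα : α < 1) (a : ℝ → ℝ) (ha : IsCutoff a) :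
    ∃ c K : ℝ, 0 < c ∧ 0 < K ∧
      ∀ (lam γ : ℝ) (N : ℕ), 1 ≤ lam → 0 < γ → (N : ℝ) = γ * lam →
      ∀ (φ p : ℝ), 0 ≤ p → p ≤ 1 →
      ∀ (Ω : Type*) [MeasurableSpace Ω] (μ : Measure Ω) [IsProbabilityMeasure μ]
        (C : Fin N → Ω → ℝ), IsUnfairCoins μ p C →
        (∀ ω, MemLp (localize a lam α (wave lam (direction N φ) (fun j => C j ω))) 2 volume) ∧
        Integrable
          (fun ω => l2NormSq (localize a lam α (wave lam (direction N φ) (fun j => C j ω)))) μ ∧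
        c * (γ * lam ^ (1 - 2 * α) + (2 * p - 1) ^ 2 * γ ^ 2 * lam ^ (1 - α)) ≤
          (∫ ω, l2NormSq (localize a lam α (wave lam (direction N φ) (fun j => C j ω))) ∂μ) ∧
        (∫ ω, l2NormSq (localize a lam α (wave lam (direction N φ) (fun j => C j ω))) ∂μ) ≤
          K * (γ * lam ^ (1 - 2 * α) + (2 * p - 1) ^ 2 * γ ^ 2 * lam ^ (1 - α)) := by
  obtain ⟨B, hB, haB⟩ := ha.exists_sq_le_gaussian
  have he : Real.exp (-1) < 1 / 2 := by
    rw [Real.exp_neg, one_div]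
    exact inv_strictAnti₀ two_pos (by linarith [Real.exp_one_gt_d9])
  refine ⟨Real.pi * (1 / 2 - Real.exp (-1)) * (Real.exp (-5) / 2), B * Real.pi * 4,
    mul_pos (mul_pos Real.pi_pos (by linarith)) (by positivity), by positivity, ?_⟩
  intro lam γ N hlam hγ hN φ p hp0 hp1 Ω _ μ _ C hC
  have hlam0 : 0 < lam := by linarith
  have hs : 0 < lam ^ α := Real.rpow_pos_of_pos hlam0 α
  -- This is where `α < 1` enters: the cut-off radius is at least of the order of the wavelength.
  have hM : 1 ≤ lam ^ (1 - α) := Real.one_le_rpow hlam (by linarith)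
  have hlamM : lam = lam ^ (1 - α) * lam ^ α := by
    rw [← Real.rpow_add hlam0]
    simp
  have hN0 : 0 < N := by
    have : (0 : ℝ) < N := hN ▸ mul_pos hγ hlam0
    exact_mod_cast this
  have hq0 : 0 ≤ (2 * p - 1) ^ 2 := sq_nonneg _
  have hq1 : (2 * p - 1) ^ 2 ≤ 1 := by nlinarith
  obtain ⟨hint, heq⟩ := ha.integral_l2NormSq hlam0 α (direction N φ) hp0 hp1 hC
  refine ⟨fun ω => ha.memLp_localize hlam0 α (continuous_wave _ _ _), hint, ?_, ?_⟩
  · rw [heq, ← scaling_identity hlam0 hN]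
    exact ha.le_integral_secondMoment hs hM hlamM hN0 hq0 hq1
  · rw [heq, ← scaling_identity hlam0 hN]
    exact integral_secondMoment_le ha hB haB hs (by linarith) hlamM hN0 hq0 hq1
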